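/- Let $H$ be a separable complex Hilbert space with inner product $(\cdot,\cdot)$, linear in the first argument, and let $A$ be an unbounded selfadjoint operator in $H$. Let $H_+:=\operatorname{dom}A$ with the graph inner product $(f,g)_+:=(f,g)+(Af,Ag)$, and let $H_+\subset H\subset H_-$ be the corresponding rigged Hilbert space: $H_-$ is the completion of $H$ with respect to $\|h\|_-:=\sup\{|(\varphi,h)|:\varphi\in H_+,\ \|\varphi\|_+=1\}$; equivalently, each $h\in H_-$ is identified with the bounded linear functional $\varphi\mapsto(\varphi,h)_{+,-}$ on $H_+$, and all bounded linear functionals on $H_+$ arise in this way. For $h\in H$ one has $(\varphi,h)_{+,-}=(\varphi,h)$. Let $\mathbf A:=A^\times\in\mathcal B(H,H_-)$ be the continuation of $A$ to $H$, given by $(f,\mathbf A g)_{+,-}=(Af,g)$ for $f\in H_+$, $g\in H$. For $Z\in\mathcal B(H,H_-)$ let $Z^\times\in\mathcal B(H_+,H)$ be given by $(Z^\times f,g)=(f,Zg)_{+,-}$ for $f\in H_+$, $g\in H$. Let $n\ge 1$ be an integer and suppose that $Z\in\mathcal B(H,H_-)$ satisfies $$\|Z\|_{H\to H_-}<1,\qquad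 \dim\operatorname{ran}Z=n,\qquad \operatorname{ran}Z\cap H=\{0\}.$$ Then the operator $T:=A+Z^\times$ in $H$ with $\operatorname{dom}T:=\operatorname{dom}A$ has the following properties. 1. $T$ is closed, and its resolvent set $\rho(T)$ meets the open upper and the open lower half-plane as well as the open right and the open left half-plane. 2. The operators $\mathbf A+\mathrm i I_H\in\mathcal B(H,H_-)$ and $I_H+(\mathbf A+\mathrm i I_H)^{-1}Z\in\mathcal B(H)$ are bijective with bounded inverses, and $$T^*=(\mathbf A+Z)\restriction\bigl(I_H+(\mathbf A+\mathrm i I_H)^{-1}Z\bigr)^{-1}H_+,$$ that is, $\operatorname{dom}T^*=\bigl(I_H+(\mathbf A+\mathrm i I_H)^{-1}Z\bigr)^{-1}H_+$ and $T^*h=\mathbf Ah+Zh$ (an element of $H\subset H_-$) for $h\in\operatorname{dom}T^*$. 3. $\operatorname{codim}(\operatorname{dom}T\cap\operatorname{dom}T^*)=n$, where the codimension of a subspace of $H$ is understood as the codimension of its closure (the dimension of its orthogonal complement). 4. If $A$ is not semibounded, i.e. neither bounded from below nor bounded from above, then the numerical range $W(T)=\{(Tu,u):u\in\operatorname{dom}T,\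 \|u\|=1\}$ is all of $\mathbb C$. 5. If $A$ has compact resolvent, then $T$ has compact resolvent. (An operator has compact resolvent if its resolvent set is non-empty and its resolvents are compact.) -/

import Mathlib

noncomputable section

namespace SingularPerturbation

open scoped InnerProductSpace LinearPMap ComplexConjugate

variable {H : Type*} [NormedAddCommGroup H] [InnerProductSpace ℂ H]

/-! ### Unbounded operators

Mathlib's inner product `⟪x, y⟫_ℂ` is conjugate-linear in the first and linear in the second
variable, so that `(x, y) = ⟪y, x⟫_ℂ` for an inner product `(·, ·)` that is linear in the first
variable. -/

/-- The operator `T` with domain `T.domain` is unbounded. -/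
def IsUnbounded (T : H →ₗ.[ℂ] H) : Prop :=
  ¬ ∃ C : ℝ, ∀ u : T.domain, ‖T u‖ ≤ C * ‖(u : H)‖

/-- The numerical range `W(T) = {(Tu, u) : u ∈ dom T, ‖u‖ = 1}`. -/
def numRange (T : H →ₗ.[ℂ] H) : Set ℂ :=
  {z | ∃ u : T.domain, ‖(u : H)‖ = 1 ∧ ⟪(u : H), T u⟫_ℂ = z}

/-- `T` is bounded from below or bounded from above, in the sense of quadratic forms
(`T` is meant to be symmetric, so that `(Tu, u)` is real). -/
def IsSemibounded (T : H →ₗ.[ℂ] H) : Prop :=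
  (∃ c : ℝ, ∀ u : T.domain, c * ‖(u : H)‖ ^ 2 ≤ (⟪(u : H), T u⟫_ℂ).re) ∨
    (∃ c : ℝ, ∀ u : T.domain, (⟪(u : H), T u⟫_ℂ).re ≤ c * ‖(u : H)‖ ^ 2)

/-- The bounded, everywhere defined operator `R` is the resolvent `(T - z)⁻¹`. -/
def IsResolventAt (T : H →ₗ.[ℂ] H) (z : ℂ) (R : H →L[ℂ] H) : Prop :=
  (∀ u : T.domain, R (T u - z • (u : H)) = u) ∧
    ∀ y : H, ∃ u : T.domain, R y = u ∧ T u - z • (u : H) = y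

/-- The resolvent set `ρ(T)`. -/
def resolventSet (T : H →ₗ.[ℂ] H) : Set ℂ :=
  {z | ∃ R : H →L[ℂ] H, IsResolventAt T z R}

/-- `T` has compact resolvent: `ρ(T)` is non-empty and the operators `(T - z)⁻¹`, `z ∈ ρ(T)`,
are compact. -/
def HasCompactResolvent (T : H →ₗ.[ℂ] H) : Prop :=
  (resolventSet T).Nonempty ∧
    ∀ (z : ℂ) (R : H →L[ℂ] H), IsResolventAt T z R → IsCompactOperator R

/-- The codimension in the Hilbert space sense of a not necessarily closed subspace `M`: the
codimension of its closure (equivalently, the dimension of its orthogonal complement). -/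
def hilbertCodim (M : Submodule ℂ H) : Cardinal :=
  Module.rank ℂ (H ⧸ M.topologicalClosure)

/-! ### The rigged Hilbert space `H₊ ⊆ H ⊆ H₋` of an operator `A` -/

/-- The space `H₊`: the domain of `A`, to be equipped with the graph inner product. -/
def HPlus (A : H →ₗ.[ℂ] H) : Type _ := A.domain

/-- An element of `H₊`, regarded as an element of `dom A`. -/
def HPlus.toDomain {A : H →ₗ.[ℂ] H} (f : HPlus A) : A.domain := f

section Graph

@[reducible] def plusAddCommGroup (A : H →ₗ.[ℂ] H) : AddCommGroup (HPlus A) :=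
  inferInstanceAs (AddCommGroup A.domain)

attribute [local instance] plusAddCommGroup

@[reducible] def plusModule (A : H →ₗ.[ℂ] H) : Module ℂ (HPlus A) :=
  inferInstanceAs (Module ℂ A.domain)

attribute [local instance] plusModule

/-- The graph inner product `(f, g)₊ = (f, g) + (Af, Ag)` on `H₊`. -/
@[reducible] def graphCore (A : H →ₗ.[ℂ] H) : InnerProductSpace.Core ℂ (HPlus A) where
  inner f g := ⟪(f.toDomain : H), (g.toDomain : H)⟫_ℂ + ⟪A f.toDomain, A g.toDomain⟫_ℂ
  conj_inner_symm f g := by simp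
  re_inner_nonneg f := by
    rw [map_add]
    exact add_nonneg inner_self_nonneg inner_self_nonneg
  add_left f g h := by
    have h1 : (f + g).toDomain = f.toDomain + g.toDomain := rfl
    rw [h1, LinearPMap.map_add, Submodule.coe_add, inner_add_left, inner_add_left]
    ring
  smul_left f g r := by
    have h1 : (r • f).toDomain = r • f.toDomain := rfl
    rw [h1, LinearPMap.map_smul, Submodule.coe_smul, inner_smul_left, inner_smul_left]
    ring
  definite f hf := by
    have h1 : (0 : ℝ) ≤ RCLike.re ⟪(f.toDomain : H), (f.toDomain : H)⟫_ℂ := inner_self_nonneg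
    have h2 : (0 : ℝ) ≤ RCLike.re ⟪A f.toDomain, A f.toDomain⟫_ℂ := inner_self_nonneg
    have h3 : RCLike.re ⟪(f.toDomain : H), (f.toDomain : H)⟫_ℂ +
        RCLike.re ⟪A f.toDomain, A f.toDomain⟫_ℂ = 0 := by
      rw [← map_add, hf, map_zero]
    have h4 : RCLike.re ⟪(f.toDomain : H), (f.toDomain : H)⟫_ℂ = 0 := by linarith
    rw [inner_self_eq_norm_sq] at h4
    have h5 : (f.toDomain : H) = 0 := norm_eq_zero.mp ((pow_eq_zero_iff two_ne_zero).mp h4)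
    have h6 : f.toDomain = 0 := Subtype.ext h5
    exact h6

instance (A : H →ₗ.[ℂ] H) : NormedAddCommGroup (HPlus A) :=
  (graphCore A).toNormedAddCommGroup

instance (A : H →ₗ.[ℂ] H) : InnerProductSpace ℂ (HPlus A) :=
  InnerProductSpace.ofCore (graphCore A).toCore

end Graph

/-- The identity map from `dom A` to `H₊`. -/
def toHPlus (A : H →ₗ.[ℂ] H) : A.domain ≃ₗ[ℂ] HPlus A where
  toFun u := u
  invFun f := f.toDomain
  map_add' _ _ := rfl
  map_smul' _ _ := rfl
  left_inv _ := rfl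
  right_inv _ := rfl

/-- The inclusion of `H₊` into `H`, as a linear map. -/
def inclₗ (A : H →ₗ.[ℂ] H) : HPlus A →ₗ[ℂ] H :=
  A.domain.subtype ∘ₗ (toHPlus A).symm.toLinearMap

/-- The operator `A` as a linear map from `H₊` to `H`. -/
def opₗ (A : H →ₗ.[ℂ] H) : HPlus A →ₗ[ℂ] H :=
  A.toFun ∘ₗ (toHPlus A).symm.toLinearMap

theorem inner_plus (A : H →ₗ.[ℂ] H) (f g : HPlus A) :
    ⟪f, g⟫_ℂ = ⟪inclₗ A f, inclₗ A g⟫_ℂ + ⟪opₗ A f, opₗ A g⟫_ℂ := rfl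

theorem norm_sq_plus (A : H →ₗ.[ℂ] H) (f : HPlus A) :
    ‖f‖ ^ 2 = ‖inclₗ A f‖ ^ 2 + ‖opₗ A f‖ ^ 2 := by
  have h := congrArg RCLike.re (inner_plus A f f)
  rw [map_add, inner_self_eq_norm_sq, inner_self_eq_norm_sq, inner_self_eq_norm_sq] at h
  exact h

/-- The inclusion `H₊ ⊆ H` as a bounded operator. -/
def incl (A : H →ₗ.[ℂ] H) : HPlus A →L[ℂ] H :=
  (inclₗ A).mkContinuous 1 fun f => by
    rw [one_mul]
    refine (sq_le_sq₀ (norm_nonneg _) (norm_nonneg _)).mp ?_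
    rw [norm_sq_plus]
    exact le_add_of_nonneg_right (sq_nonneg _)

/-- The operator `A` as an element of `B(H₊, H)`. -/
def op (A : H →ₗ.[ℂ] H) : HPlus A →L[ℂ] H :=
  (opₗ A).mkContinuous 1 fun f => by
    rw [one_mul]
    refine (sq_le_sq₀ (norm_nonneg _) (norm_nonneg _)).mp ?_
    rw [norm_sq_plus]
    exact le_add_of_nonneg_left (sq_nonneg _)

/-- The space `H₋`: the bounded conjugate-linear functionals on `H₊`, with the norm
`‖h‖₋ = sup {|h φ| : ‖φ‖₊ ≤ 1}`. An element `h` is determined by the linear functional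
`φ ↦ (φ, h) = conj (h φ)`; since functionals are taken conjugate-linear, `H ⊆ H₋` is a
linear embedding. -/
abbrev HMinus (A : H →ₗ.[ℂ] H) : Type _ := HPlus A →L⋆[ℂ] ℂ

/-- The canonical pairing `(f, h)` of `f ∈ H₊` and `h ∈ H₋`, linear in `f`. -/
def pairing (A : H →ₗ.[ℂ] H) (f : HPlus A) (h : HMinus A) : ℂ := conj (h f)

/-- The adjoint `B^× ∈ B(H, H₋)` of `B ∈ B(H₊, H)`: `(Bf, g) = (f, B^× g)`
for `f ∈ H₊`, `g ∈ H`. -/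
def adjOfPlus {A : H →ₗ.[ℂ] H} (B : HPlus A →L[ℂ] H) : H →L[ℂ] HMinus A :=
  ((innerSL ℂ).comp B).flip

theorem adjOfPlus_apply {A : H →ₗ.[ℂ] H} (B : HPlus A →L[ℂ] H) (g : H) (f : HPlus A) :
    adjOfPlus B g f = ⟪B f, g⟫_ℂ := rfl

theorem pairing_adjOfPlus {A : H →ₗ.[ℂ] H} (B : HPlus A →L[ℂ] H) (f : HPlus A) (g : H) :
    pairing A f (adjOfPlus B g) = ⟪g, B f⟫_ℂ := by
  simp [pairing, adjOfPlus_apply]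

/-- The embedding `H ⊆ H₋`, which sends `h` to the element of `H₋` whose pairing with
`f ∈ H₊` is `(f, h)`. -/
def emb (A : H →ₗ.[ℂ] H) : H →L[ℂ] HMinus A := adjOfPlus (incl A)

/-- The operator `𝐀 = A^× ∈ B(H, H₋)`. -/
def opExt (A : H →ₗ.[ℂ] H) : H →L[ℂ] HMinus A := adjOfPlus (op A)

/-- The adjoint `Z^× ∈ B(H₊, H)` of `Z ∈ B(H, H₋)`: `(Z^× f, g) = (f, Zg)`
for `f ∈ H₊`, `g ∈ H`. -/
def adjOfMinus [CompleteSpace H] {A : H →ₗ.[ℂ] H} (Z : H →L[ℂ] HMinus A) : HPlus A →L[ℂ] H :=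
  ((InnerProductSpace.toDual ℂ H).symm.toContinuousLinearEquiv.toContinuousLinearMap).comp Z.flip

theorem inner_adjOfMinus [CompleteSpace H] {A : H →ₗ.[ℂ] H} (Z : H →L[ℂ] HMinus A)
    (f : HPlus A) (g : H) : ⟪adjOfMinus Z f, g⟫_ℂ = Z g f := by
  simp [adjOfMinus]

theorem pairing_apply [CompleteSpace H] {A : H →ₗ.[ℂ] H} (Z : H →L[ℂ] HMinus A)
    (f : HPlus A) (g : H) : pairing A f (Z g) = ⟪g, adjOfMinus Z f⟫_ℂ := by
  rw [pairing, ← inner_adjOfMinus, inner_conj_symm]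

/-- The operator `T = A + Z^×` in `H`, with `dom T = dom A`. -/
def singularPert [CompleteSpace H] (A : H →ₗ.[ℂ] H) (Z : H →L[ℂ] HMinus A) : H →ₗ.[ℂ] H where
  domain := A.domain
  toFun := A.toFun + (adjOfMinus Z).toLinearMap ∘ₗ (toHPlus A).toLinearMap

end SingularPerturbation

end

noncomputable section

namespace SingularPerturbation

open scoped InnerProductSpace LinearPMap ComplexConjugate

variable {H : Type*} [NormedAddCommGroup H] [InnerProductSpace ℂ H]

/-! ### Resolvents -/

/-! For σ = ±i the map A + σ is unitary from H₊ onto H, while Z^× has norm < 1 from H₊ to H, so A +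
σ + Z^× stays invertible by a Neumann series (`exists_equiv_of_norm_lt_one`). Hence ∓i ∈ ρ(T), T is
closed, and compactness of the resolvent passes from A to T.

By duality, h ∈ dom T* with T*h = w means 𝐀h + Zh = w in H₋ (`mem_adjoint_iff`). Since 𝐀 + i is
unitary from H to H₋ and dom A is exactly the preimage of H under it, the formula for T* follows.
For h ∈ dom A the condition reads Zh ∈ H, i.e. Zh = 0, so dom T ∩ dom T* = dom A ∩ ker Z. Finite
rank makes this dense in ker Z, which has codimension n.

W(T) is convex (`convex_numRange`). On dom A ∩ ker Z the form of T is that of A, and it remains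
unbounded in both directions there (`exists_form_approx`), so W(T) contains ℝ. Moreover Im (Tu, u) =
Im (Z^×u, u), and ran Z ∩ H = {0} lets u and Z^×u be prescribed independently up to small errors
(`mem_closure_graph`). So the imaginary parts are unbounded in both directions too, and such a
convex set is ℂ. -/

theorem isClosed_of_isResolventAt {T : H →ₗ.[ℂ] H} {z : ℂ} {R : H →L[ℂ] H}
    (h : IsResolventAt T z R) : T.IsClosed := by
  have hg : (T.graph : Set (H × H)) = {p | R (p.2 - z • p.1) = p.1} := by
    ext ⟨x, y⟩
    simp only [SetLike.mem_coe, LinearPMap.mem_graph_iff, Set.mem_ofPred_eq]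
    constructor
    · rintro ⟨u, rfl, rfl⟩
      exact h.1 u
    · intro hR
      obtain ⟨u, hu, hTu⟩ := h.2 (y - z • x)
      have hux : (u : H) = x := hu.symm.trans hR
      refine ⟨u, hux, ?_⟩
      rwa [hux, sub_left_inj] at hTu
  unfold LinearPMap.IsClosed
  rw [hg]
  exact isClosed_eq (by fun_prop) (by fun_prop)

/-- The first resolvent identity. -/
theorem resolvent_identity {T : H →ₗ.[ℂ] H} {z w : ℂ} {R S : H →L[ℂ] H}
    (hR : IsResolventAt T z R) (hS : IsResolventAt T w S) :
    S = R + (w - z) • R.comp S := by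
  ext y
  obtain ⟨u, hu, hTu⟩ := hS.2 y
  have h := hR.1 u
  have e : T u - z • (u : H) = y + (w - z) • (u : H) := by
    rw [← hTu, sub_smul]; abel
  rw [e, map_add, map_smul] at h
  change S y = R y + (w - z) • R (S y)
  rw [hu]
  exact h.symm

/-- With U = 1 - (w - z)R one has T - w = U(T - z), and U is invertible by a Neumann series, so R
U⁻¹ is the resolvent at w. -/
theorem isResolventAt_of_near [CompleteSpace H] {T : H →ₗ.[ℂ] H} {z w : ℂ} {R : H →L[ℂ] H}
    (hR : IsResolventAt T z R) (hw : ‖(w - z) • R‖ < 1) : w ∈ resolventSet T := by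
  obtain ⟨U, hU⟩ := isUnit_one_sub_of_norm_lt_one hw
  have h1 (x : H) : U.val (U.inv x) = x := DFunLike.congr_fun U.val_inv x
  have h2 (x : H) : U.inv (U.val x) = x := DFunLike.congr_fun U.inv_val x
  have h3 (x : H) : U.val x = x - (w - z) • R x := by simp [hU]
  have h4 (x : H) : R (U.val x) = U.val (R x) := by simp [h3]
  refine ⟨R.comp U.inv, fun u => ?_, fun y => ?_⟩
  · have h5 : T u - w • (u : H) = U.val (T u - z • (u : H)) := by
      rw [h3, hR.1, sub_smul]; abel
    rw [ContinuousLinearMap.comp_apply, h5, h2, hR.1]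
  · obtain ⟨u, hu, hTu⟩ := hR.2 (U.inv y)
    refine ⟨u, hu, ?_⟩
    have h5 := h1 y
    rw [h3, hu, ← hTu, sub_smul] at h5
    rw [← h5]; abel

theorem isOpen_resolventSet [CompleteSpace H] (T : H →ₗ.[ℂ] H) : IsOpen (resolventSet T) := by
  rw [isOpen_iff_mem_nhds]
  rintro z ⟨R, hR⟩
  have hc : Continuous fun w : ℂ => ‖(w - z) • R‖ := by fun_prop
  filter_upwards [hc.continuousAt.eventually_lt (continuousAt_const (y := (1 : ℝ)))
    (by simp)] with w hw using isResolventAt_of_near hR hw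

/-- If one resolvent is compact, all are. -/
theorem hasCompactResolvent_of_isResolventAt {T : H →ₗ.[ℂ] H} {z : ℂ} {R : H →L[ℂ] H}
    (hR : IsResolventAt T z R) (hc : IsCompactOperator R) : HasCompactResolvent T := by
  refine ⟨⟨z, R, hR⟩, fun w S hS => ?_⟩
  rw [resolvent_identity hR hS]
  exact hc.add ((hc.comp_clm S).smul (w - z))

theorem exists_re_of_mem_resolventSet [CompleteSpace H] {T : H →ₗ.[ℂ] H}
    (h : Complex.I ∈ resolventSet T) :
    (∃ z ∈ resolventSet T, 0 < z.re) ∧ ∃ z ∈ resolventSet T, z.re < 0 := by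
  obtain ⟨ε, hε, hb⟩ := Metric.isOpen_iff.mp (isOpen_resolventSet T) _ h
  refine ⟨⟨Complex.I + ((ε / 2 : ℝ) : ℂ), hb ?_, ?_⟩,
    ⟨Complex.I + ((-(ε / 2) : ℝ) : ℂ), hb ?_, ?_⟩⟩
  · rw [Metric.mem_ball, dist_eq_norm, add_sub_cancel_left, Complex.norm_real,
      Real.norm_of_nonneg (by positivity)]
    linarith
  · simpa using hε
  · rw [Metric.mem_ball, dist_eq_norm, add_sub_cancel_left, Complex.norm_real, norm_neg,
      Real.norm_of_nonneg (by positivity)]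
    linarith
  · simpa using hε

/-! ### The Toeplitz–Hausdorff theorem -/

/-- A sesquilinear form that takes values of opposite directions has an isotropic vector. -/
theorem exists_isotropic {V : Type*} [AddCommGroup V] [Module ℂ V] (B : V →ₗ⋆[ℂ] V →ₗ[ℂ] ℂ)
    {u v : V} {c : ℂ} {a b : ℝ} (hc : c ≠ 0) (ha : 0 < a) (hb : 0 < b)
    (hu : B u u = -(a * c)) (hv : B v v = b * c) : ∃ x : V, x ≠ 0 ∧ B x x = 0 := by
  obtain ⟨ω, r, hω, hr⟩ : ∃ (ω : ℂ) (r : ℝ), ω ≠ 0 ∧ ω * B u v + conj ω * B v u = r * c := by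
    set β := B u v / c with hβ
    set γ := B v u / c with hγ
    -- The imaginary part is that of ω(β - conj γ), so ω = conj(β - conj γ) works unless this is 0,
    -- when any ω does.
    obtain ⟨ω, hω, him⟩ : ∃ ω : ℂ, ω ≠ 0 ∧ (ω * β + conj ω * γ).im = 0 := by
      by_cases h : β - conj γ = 0
      · refine ⟨1, one_ne_zero, ?_⟩
        rw [sub_eq_zero.mp h]; simp
      · refine ⟨conj (β - conj γ), (map_ne_zero _).mpr h, ?_⟩
        simp; ring
    refine ⟨ω, (ω * β + conj ω * γ).re, hω, ?_⟩
    have : ((ω * β + conj ω * γ).re : ℂ) = ω * β + conj ω * γ :=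
      Complex.ext (by simp) (by rw [him]; simp)
    rw [this, hβ, hγ]
    field_simp
  set b' : ℝ := b * ‖ω‖ ^ 2 with hb'
  have hb'0 : 0 < b' := by positivity
  -- Along u + tωv the form equals c times this real quadratic in t, whose discriminant is positive
  -- because a and b' are.
  obtain ⟨t, ht⟩ : ∃ t : ℝ, b' * (t * t) + r * t + -a = 0 := by
    refine exists_quadratic_eq_zero hb'0.ne' ⟨√(r ^ 2 - 4 * b' * -a), ?_⟩
    rw [Real.mul_self_sqrt (by nlinarith [sq_nonneg r, mul_pos hb'0 ha])]
    rfl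
  have hωω : conj ω * ω = ((‖ω‖ ^ 2 : ℝ) : ℂ) := by
    rw [mul_comm, Complex.mul_conj, Complex.normSq_eq_norm_sq]
  refine ⟨u + ((t : ℂ) * ω) • v, fun hx => ?_, ?_⟩
  -- If the vector vanished, u would be a multiple of v, making B u u a nonnegative multiple of c.
  · have h1 : u = (-((t : ℂ) * ω)) • v := by rw [neg_smul]; exact eq_neg_of_add_eq_zero_left hx
    have h2 : B u u = ((t ^ 2 * ‖ω‖ ^ 2 * b : ℝ) : ℂ) * c := by
      rw [h1]
      simp only [map_smulₛₗ, LinearMap.smul_apply, smul_eq_mul, map_neg, map_mul,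
        Complex.conj_ofReal, RingHom.id_apply, hv]
      push_cast at hωω ⊢
      linear_combination (t : ℂ) ^ 2 * b * c * hωω
    rw [hu, ← neg_mul] at h2
    have h3 := mul_right_cancel₀ hc h2
    have h4 : -a = t ^ 2 * ‖ω‖ ^ 2 * b := by exact_mod_cast h3
    have : 0 ≤ t ^ 2 * ‖ω‖ ^ 2 * b := by positivity
    linarith
  · simp only [map_add, map_smulₛₗ, LinearMap.add_apply, LinearMap.smul_apply, smul_eq_mul,
      map_mul, Complex.conj_ofReal, RingHom.id_apply, hu, hv]
    have ht' : ((b * ‖ω‖ ^ 2 : ℝ) : ℂ) * (t * t) + r * t + -a = 0 := by exact_mod_cast ht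
    push_cast at ht' hωω
    linear_combination c * ht' + (t : ℂ) * hr + (t : ℂ) ^ 2 * b * c * hωω

/-- The form `(x, y) ↦ ⟪x, T y - z y⟫` on the domain of `T`. -/
def shiftedForm (T : H →ₗ.[ℂ] H) (z : ℂ) : T.domain →ₗ⋆[ℂ] T.domain →ₗ[ℂ] ℂ :=
  ((innerₛₗ ℂ).comp T.domain.subtype).compl₂ (T.toFun - z • T.domain.subtype)

theorem shiftedForm_apply (T : H →ₗ.[ℂ] H) (z : ℂ) (u v : T.domain) :
    shiftedForm T z u v = ⟪(u : H), T v - z • (v : H)⟫_ℂ := rfl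

theorem mem_numRange_of_shiftedForm {T : H →ₗ.[ℂ] H} {z : ℂ} {u : T.domain} (hu : u ≠ 0)
    (h : shiftedForm T z u u = 0) : z ∈ numRange T := by
  have hn : (‖(u : H)‖ : ℂ) ≠ 0 := by simpa using hu
  refine ⟨((‖(u : H)‖⁻¹ : ℝ) : ℂ) • u, ?_, ?_⟩
  · rw [Submodule.coe_smul, norm_smul, Complex.norm_real, norm_inv, norm_norm,
      inv_mul_cancel₀ (by simpa using hu)]
  · rw [shiftedForm_apply, inner_sub_right, inner_smul_right, sub_eq_zero,
      inner_self_eq_norm_sq_to_K] at h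
    rw [LinearPMap.map_smul, Submodule.coe_smul, inner_smul_left, inner_smul_right, h]
    simp
    field_simp

/-- The **Toeplitz–Hausdorff theorem**. -/
theorem convex_numRange (T : H →ₗ.[ℂ] H) : Convex ℝ (numRange T) := by
  rw [convex_iff_forall_pos]
  rintro p ⟨u, hu, hp⟩ q ⟨v, hv, hq⟩ a b ha hb hab
  by_cases hpq : p = q
  · subst hpq
    rw [← add_smul, hab, one_smul]
    exact ⟨u, hu, hp⟩
  have hab' : (a : ℂ) = 1 - b := by rw [← Complex.ofReal_one, ← hab]; simp
  -- For z = ap + bq the shifted values are p - z = -b(q - p) and q - z = a(q - p), so the weights a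
  -- and b swap roles.
  obtain ⟨x, hx, hBx⟩ := exists_isotropic (shiftedForm T (a • p + b • q)) (u := u) (v := v)
    (c := q - p) (sub_ne_zero.mpr (Ne.symm hpq)) hb ha
    (by
      rw [shiftedForm_apply, inner_sub_right, inner_smul_right, hp, inner_self_eq_norm_sq_to_K, hu]
      simp only [Complex.real_smul, hab']
      simp; ring)
    (by
      rw [shiftedForm_apply, inner_sub_right, inner_smul_right, hq, inner_self_eq_norm_sq_to_K, hv]
      simp only [Complex.real_smul, hab']
      simp; ring)
  exact mem_numRange_of_shiftedForm hx hBx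

/-- A convex subset of the plane that contains the real axis and points with arbitrarily large and
arbitrarily small imaginary parts is the whole plane. -/
theorem eq_univ_of_convex {S : Set ℂ} (hS : Convex ℝ S) (hre : ∀ x : ℝ, (x : ℂ) ∈ S)
    (hup : ∀ c : ℝ, ∃ p ∈ S, c < p.im) (hlo : ∀ c : ℝ, ∃ p ∈ S, p.im < c) : S = Set.univ := by
  -- Here z = (1 - t)r + tp, where r is the point in which the line through p and z meets the real
  -- axis.
  have key (z p : ℂ) (hp : p ∈ S) (t : ℝ) (ht0 : 0 < t) (ht1 : t < 1) (h : z.im = t * p.im) :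
      z ∈ S := by
    have h1 : 1 - t ≠ 0 := by linarith
    obtain ⟨r, hr⟩ : ∃ r : ℝ, (1 - t) * r = z.re - t * p.re := ⟨_, mul_div_cancel₀ _ h1⟩
    convert hS (hre r) hp (by linarith : (0 : ℝ) ≤ 1 - t) ht0.le (by ring) using 1
    apply Complex.ext
    · simp only [Complex.add_re, Complex.smul_re, Complex.ofReal_re, smul_eq_mul]
      linarith
    · simp [h]
  refine Set.eq_univ_of_forall fun z => ?_
  rcases lt_trichotomy z.im 0 with h | h | h
  · obtain ⟨p, hp, hpz⟩ := hlo z.im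
    exact key z p hp (z.im / p.im) (div_pos_of_neg_of_neg h (hpz.trans h))
      ((div_lt_one_of_neg (hpz.trans h)).mpr hpz) (by field_simp [(hpz.trans h).ne])
  · have := hre z.re
    rwa [show ((z.re : ℝ) : ℂ) = z from Complex.ext (by simp) (by simp [h])] at this
  · obtain ⟨p, hp, hpz⟩ := hup z.im
    exact key z p hp (z.im / p.im) (div_pos h (h.trans hpz))
      ((div_lt_one (h.trans hpz)).mpr hpz) (by field_simp [(h.trans hpz).ne'])

/-! ### The space `H₊` of a selfadjoint operator -/

theorem incl_toHPlus (A : H →ₗ.[ℂ] H) (u : A.domain) : incl A (toHPlus A u) = u := rfl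

theorem op_toHPlus (A : H →ₗ.[ℂ] H) (u : A.domain) : op A (toHPlus A u) = A u := rfl

theorem incl_mem (A : H →ₗ.[ℂ] H) (f : HPlus A) : incl A f ∈ A.domain := f.toDomain.2

theorem norm_sq_HPlus (A : H →ₗ.[ℂ] H) (f : HPlus A) : ‖f‖ ^ 2 = ‖incl A f‖ ^ 2 + ‖op A f‖ ^ 2 :=
  norm_sq_plus A f

/-- The map f ↦ (f, Af) identifies H₊, up to equivalence of norms, with the closed graph of A. -/
theorem completeSpace_HPlus [CompleteSpace H] {A : H →ₗ.[ℂ] H} (hA : A.IsClosed) :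
    CompleteSpace (HPlus A) := by
  set j : HPlus A →L[ℂ] H × H := (incl A).prod (op A) with hj
  have hanti : AntilipschitzWith 2 j := j.antilipschitz_of_bound fun f => by
    have h1 : ‖incl A f‖ ≤ ‖j f‖ := le_max_left _ _
    have h2 : ‖op A f‖ ≤ ‖j f‖ := le_max_right _ _
    have h3 := norm_sq_HPlus A f
    refine abs_le_of_sq_le_sq' ?_ (by positivity) |>.2
    rw [h3]
    push_cast
    nlinarith [norm_nonneg (incl A f), norm_nonneg (op A f)]
  rw [completeSpace_iff_isComplete_range (hanti.isUniformInducing j.uniformContinuous)]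
  have hr : Set.range j = (A.graph : Set (H × H)) := by
    ext ⟨x, y⟩
    simp only [Set.mem_range, SetLike.mem_coe, LinearPMap.mem_graph_iff]
    constructor
    · rintro ⟨f, hf⟩
      exact ⟨f.toDomain, congrArg Prod.fst hf, congrArg Prod.snd hf⟩
    · rintro ⟨u, rfl, rfl⟩
      exact ⟨toHPlus A u, rfl⟩
  rw [hr]
  exact IsClosed.isComplete hA

theorem inner_op_incl [CompleteSpace H] {A : H →ₗ.[ℂ] H} (hA : IsSelfAdjoint A) (f g : HPlus A) :
    ⟪op A f, incl A g⟫_ℂ = ⟪incl A f, op A g⟫_ℂ := by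
  have h := LinearPMap.adjoint_isFormalAdjoint hA.dense_domain
  rw [LinearPMap.isSelfAdjoint_def.mp hA] at h
  exact h f.toDomain g.toDomain

theorem im_inner_op [CompleteSpace H] {A : H →ₗ.[ℂ] H} (hA : IsSelfAdjoint A) (f : HPlus A) :
    (⟪incl A f, op A f⟫_ℂ).im = 0 := by
  rw [← Complex.conj_eq_iff_im, inner_conj_symm, inner_op_incl hA]

/-- The operator `A + σ` on `H₊`. -/
def shift (A : H →ₗ.[ℂ] H) (σ : ℂ) : HPlus A →L[ℂ] H := op A + σ • incl A

theorem shift_apply (A : H →ₗ.[ℂ] H) (σ : ℂ) (f : HPlus A) :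
    shift A σ f = op A f + σ • incl A f := rfl

/-- The cross term vanishes: (Af, f) is real and σ is purely imaginary. -/
theorem norm_shift [CompleteSpace H] {A : H →ₗ.[ℂ] H} (hA : IsSelfAdjoint A) {σ : ℂ}
    (hσ : ‖σ‖ = 1) (hσ' : σ.re = 0) (f : HPlus A) : ‖shift A σ f‖ = ‖f‖ := by
  refine (sq_eq_sq₀ (norm_nonneg _) (norm_nonneg _)).mp ?_
  have h := im_inner_op hA f
  rw [← inner_op_incl hA] at h
  rw [norm_sq_HPlus, shift_apply, @norm_add_sq ℂ, norm_smul, hσ, inner_smul_right]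
  simp [hσ', h]
  ring

/-- The range of an isometry on a complete space is closed. A vector g orthogonal to it lies in dom
A* = dom A with Ag = σg, and since (Ag, g) is real, g = 0. -/
theorem shift_surjective [CompleteSpace H] {A : H →ₗ.[ℂ] H} (hA : IsSelfAdjoint A) {σ : ℂ}
    (hσ : ‖σ‖ = 1) (hσ' : σ.re = 0) : Function.Surjective (shift A σ) := by
  have := completeSpace_HPlus hA.isClosed
  have hconj : conj σ = -σ := Complex.ext (by simp [hσ']) (by simp)
  have hanti : AntilipschitzWith 1 (shift A σ) :=
    (shift A σ).antilipschitz_of_bound fun f => by simp [norm_shift hA hσ hσ']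
  have hcl := hanti.isClosed_range (shift A σ).uniformContinuous
  have horth : (LinearMap.range (shift A σ).toLinearMap)ᗮ = ⊥ := by
    rw [Submodule.eq_bot_iff]
    intro g hg
    have hg' (f : HPlus A) : ⟪op A f + σ • incl A f, g⟫_ℂ = 0 :=
      (Submodule.mem_orthogonal _ _).mp hg _ ⟨f, rfl⟩
    have hw (u : A.domain) : ⟪σ • g, (u : H)⟫_ℂ = ⟪g, A u⟫_ℂ := by
      have h := hg' (toHPlus A u)
      rw [← inner_conj_symm, map_eq_zero, inner_add_right, inner_smul_right, op_toHPlus,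
        incl_toHPlus] at h
      rw [inner_smul_left, hconj]
      linear_combination -h
    have hmem : g ∈ A†.domain := LinearPMap.mem_adjoint_domain_of_exists g ⟨σ • g, hw⟩
    have happ : A† ⟨g, hmem⟩ = σ • g := LinearPMap.adjoint_apply_eq hA.dense_domain _ hw
    obtain ⟨g', hg1, hg2⟩ : ∃ g' : HPlus A, incl A g' = g ∧ op A g' = σ • g := by
      -- The membership proof depends on the operator, so A† = A is used by substitution for a
      -- variable B.
      have key : ∀ B : H →ₗ.[ℂ] H, B = A → ∀ hB : g ∈ B.domain, B ⟨g, hB⟩ = σ • g →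
          ∃ g' : HPlus A, incl A g' = g ∧ op A g' = σ • g := by
        rintro _ rfl hB h
        exact ⟨toHPlus _ ⟨g, hB⟩, rfl, h⟩
      exact key _ (LinearPMap.isSelfAdjoint_def.mp hA) hmem happ
    have h := im_inner_op hA g'
    rw [hg1, hg2, inner_smul_right, inner_self_eq_norm_sq_to_K] at h
    have hσi : σ.im ≠ 0 := fun h0 => by
      rw [show σ = 0 from Complex.ext hσ' h0] at hσ
      simp at hσ
    have h' : σ.im * ‖g‖ ^ 2 = 0 := by
      rw [← h, Complex.mul_im, hσ']
      simp [← Complex.ofReal_pow]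
    simpa [hσi] using h'
  have htop := Submodule.topologicalClosure_eq_top_iff.mpr horth
  intro y
  have hy : y ∈ (LinearMap.range (shift A σ).toLinearMap).topologicalClosure := htop ▸ trivial
  have hy' : y ∈ closure (Set.range (shift A σ)) := hy
  rwa [hcl.closure_eq] at hy'

/-- The unitary operator `A + σ` from `H₊` to `H`, for `σ = ± i`. -/
def shiftEquiv [CompleteSpace H] {A : H →ₗ.[ℂ] H} (hA : IsSelfAdjoint A) {σ : ℂ}
    (hσ : ‖σ‖ = 1) (hσ' : σ.re = 0) : HPlus A ≃ₗᵢ[ℂ] H :=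
  LinearIsometryEquiv.ofSurjective ⟨(shift A σ).toLinearMap, norm_shift hA hσ hσ'⟩
    (shift_surjective hA hσ hσ')

theorem shiftEquiv_apply [CompleteSpace H] {A : H →ₗ.[ℂ] H} (hA : IsSelfAdjoint A) {σ : ℂ}
    (hσ : ‖σ‖ = 1) (hσ' : σ.re = 0) (f : HPlus A) :
    shiftEquiv hA hσ hσ' f = op A f + σ • incl A f := rfl

/-! ### The resolvent of the perturbed operator -/

section Perturbation

variable [CompleteSpace H] {A : H →ₗ.[ℂ] H} (Z : H →L[ℂ] HMinus A)

theorem norm_adjOfMinus_le : ‖adjOfMinus Z‖ ≤ ‖Z‖ := by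
  refine ContinuousLinearMap.opNorm_le_bound _ (norm_nonneg Z) fun f => ?_
  calc ‖adjOfMinus Z f‖ = ‖Z.flip f‖ := by simp [adjOfMinus]
    _ ≤ ‖Z‖ * ‖f‖ := by
      rw [← Z.opNorm_flip]
      exact Z.flip.le_opNorm f

theorem singularPert_apply (u : (singularPert A Z).domain) :
    singularPert A Z u = op A (toHPlus A u) + adjOfMinus Z (toHPlus A u) := rfl

theorem isResolventAt_singularPert {z : ℂ} (e : HPlus A ≃L[ℂ] H)
    (he : ∀ f, e f = op A f + adjOfMinus Z f - z • incl A f) :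
    IsResolventAt (singularPert A Z) z ((incl A).comp e.symm.toContinuousLinearMap) := by
  refine ⟨fun u => ?_, fun y => ⟨(e.symm y).toDomain, rfl, ?_⟩⟩
  · have h : singularPert A Z u - z • (u : H) = e (toHPlus A u) := by
      rw [he, singularPert_apply]; rfl
    rw [h]
    exact congrArg (incl A) (e.symm_apply_apply _)
  · have h := he (e.symm y)
    rw [e.apply_symm_apply] at h
    exact h.symm

theorem isUnit_one_add_of_norm_lt_one {B : H →L[ℂ] H} (hB : ‖B‖ < 1) : IsUnit (1 + B) := by
  rw [← sub_neg_eq_add]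
  exact isUnit_one_sub_of_norm_lt_one (by rwa [norm_neg])

variable {Z}

/-- If `‖Z‖ < 1`, then `A + σ + Z^×` is an isomorphism of `H₊` onto `H` for `σ = ± i`. -/
theorem exists_equiv_of_norm_lt_one (hA : IsSelfAdjoint A) (hZ : ‖Z‖ < 1) {σ : ℂ}
    (hσ : ‖σ‖ = 1) (hσ' : σ.re = 0) :
    ∃ V : H ≃L[ℂ] H, ∀ f, V (shiftEquiv hA hσ hσ' f) = op A f + adjOfMinus Z f + σ • incl A f := by
  set S := shiftEquiv hA hσ hσ' with hS
  -- A + Z^× + σ = (1 + B)S, and B is a strict contraction because S is unitary.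
  set B : H →L[ℂ] H :=
    (adjOfMinus Z).comp S.symm.toContinuousLinearEquiv.toContinuousLinearMap with hB
  have hn : ‖B‖ < 1 := by
    refine lt_of_le_of_lt (ContinuousLinearMap.opNorm_le_bound _ (norm_nonneg Z) fun x => ?_) hZ
    calc ‖adjOfMinus Z (S.symm x)‖ ≤ ‖adjOfMinus Z‖ * ‖S.symm x‖ :=
        (adjOfMinus Z).le_opNorm _
      _ ≤ ‖Z‖ * ‖x‖ := by
        rw [S.symm.norm_map]
        gcongr
        exact norm_adjOfMinus_le Z
  obtain ⟨U, hU⟩ := isUnit_one_add_of_norm_lt_one hn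
  refine ⟨ContinuousLinearEquiv.unitsEquiv ℂ H U, fun f => ?_⟩
  change (U : H →L[ℂ] H) (S f) = _
  have h : B (S f) = adjOfMinus Z f := congrArg (adjOfMinus Z) (S.symm_apply_apply f)
  rw [hU, add_apply, h, one_apply_eq_self, hS, shiftEquiv_apply]
  abel

theorem mem_resolventSet_singularPert (hA : IsSelfAdjoint A) (hZ : ‖Z‖ < 1) {σ : ℂ}
    (hσ : ‖σ‖ = 1) (hσ' : σ.re = 0) : -σ ∈ resolventSet (singularPert A Z) := by
  obtain ⟨V, hV⟩ := exists_equiv_of_norm_lt_one hA hZ hσ hσ'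
  exact ⟨_, isResolventAt_singularPert Z
    ((shiftEquiv hA hσ hσ').toContinuousLinearEquiv.trans V) fun f => by
      rw [neg_smul, sub_neg_eq_add]
      exact hV f⟩

/-- The factorization T + i = V(A + i) gives (T + i)⁻¹ = (A + i)⁻¹V⁻¹, a compact operator times a
bounded one. -/
theorem hasCompactResolvent_singularPert (hA : IsSelfAdjoint A) (hZ : ‖Z‖ < 1)
    (hc : HasCompactResolvent A) : HasCompactResolvent (singularPert A Z) := by
  set S := shiftEquiv hA Complex.norm_I Complex.I_re with hS
  obtain ⟨V, hV⟩ := exists_equiv_of_norm_lt_one hA hZ Complex.norm_I Complex.I_re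
  set R : H →L[ℂ] H := (incl A).comp S.symm.toContinuousLinearEquiv.toContinuousLinearMap
  have hR : IsResolventAt A (-Complex.I) R := by
    refine ⟨fun u => ?_, fun y => ⟨(S.symm y).toDomain, rfl, ?_⟩⟩
    · have h : A u - (-Complex.I) • (u : H) = S (toHPlus A u) := by
        rw [neg_smul, sub_neg_eq_add]; rfl
      rw [h]
      exact congrArg (incl A) (S.symm_apply_apply _)
    · rw [neg_smul, sub_neg_eq_add]
      exact S.apply_symm_apply y
  refine hasCompactResolvent_of_isResolventAt (z := -Complex.I)
    (isResolventAt_singularPert Z (S.toContinuousLinearEquiv.trans V) fun f => ?_) ?_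
  · rw [neg_smul, sub_neg_eq_add]
    exact hV f
  · exact (hc.2 _ R hR).comp_clm V.symm.toContinuousLinearMap

/-! ### The adjoint of the perturbed operator -/

variable (Z) in
-- Testing an equation in H₋ against every element of H₊ is the defining relation of the adjoint,
-- since dom T = dom A.
theorem mem_adjoint_iff {h w : H} :
    (∀ u : (singularPert A Z).domain, ⟪w, (u : H)⟫_ℂ = ⟪h, singularPert A Z u⟫_ℂ) ↔
      (opExt A + Z) h = emb A w := by
  have key (f : HPlus A) : (opExt A + Z) h f = ⟪op A f + adjOfMinus Z f, h⟫_ℂ := by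
    rw [inner_add_left, inner_adjOfMinus]
    rfl
  constructor
  · intro H1
    ext f
    rw [key, ← inner_conj_symm]
    exact (congrArg conj (H1 f.toDomain).symm).trans (inner_conj_symm _ _)
  · intro H1 u
    have := DFunLike.congr_fun H1 (toHPlus A u)
    rw [key] at this
    rw [singularPert_apply, ← inner_conj_symm, ← inner_conj_symm h, this]
    rfl

theorem emb_adjoint_apply (hA : IsSelfAdjoint A) (u : (singularPert A Z).adjoint.domain) :
    emb A ((singularPert A Z).adjoint u) = (opExt A + Z) (u : H) :=
  ((mem_adjoint_iff Z).mp
    (LinearPMap.adjoint_isFormalAdjoint (T := singularPert A Z) hA.dense_domain u)).symm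

theorem mem_adjoint_domain_iff_exists (hA : IsSelfAdjoint A) {h : H} :
    h ∈ (singularPert A Z).adjoint.domain ↔ ∃ w, (opExt A + Z) h = emb A w := by
  constructor
  · exact fun hh => ⟨_, (emb_adjoint_apply hA ⟨h, hh⟩).symm⟩
  · rintro ⟨w, hw⟩
    exact LinearPMap.mem_adjoint_domain_of_exists h ⟨w, (mem_adjoint_iff Z).mpr hw⟩

theorem opExt_incl (hA : IsSelfAdjoint A) (f : HPlus A) : opExt A (incl A f) = emb A (op A f) := by
  ext g
  exact inner_op_incl hA g f

theorem norm_neg_I : ‖-Complex.I‖ = 1 ∧ (-Complex.I).re = 0 := by simp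

/-- This exhibits 𝐀 + i as the dual of the unitary A - i : H₊ → H, whence it is unitary too. -/
theorem opExt_add_emb_apply (hA : IsSelfAdjoint A) (g : H) (f : HPlus A) :
    (opExt A + Complex.I • emb A) g f =
      ⟪shiftEquiv hA norm_neg_I.1 norm_neg_I.2 f, g⟫_ℂ := by
  rw [shiftEquiv_apply, inner_add_left, inner_smul_left]
  simp [opExt, emb, adjOfPlus_apply]

theorem norm_opExt_add_emb (hA : IsSelfAdjoint A) (g : H) :
    ‖(opExt A + Complex.I • emb A) g‖ = ‖g‖ := by
  set S := shiftEquiv hA norm_neg_I.1 norm_neg_I.2 with hS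
  refine le_antisymm (ContinuousLinearMap.opNorm_le_bound _ (norm_nonneg _) fun f => ?_) ?_
  · rw [opExt_add_emb_apply hA, mul_comm]
    exact (norm_inner_le_norm _ _).trans_eq (by rw [LinearIsometryEquiv.norm_map])
  · by_cases hg : g = 0
    · simp [hg]
    -- The norm is attained at (A - i)⁻¹g.
    have h := ((opExt A + Complex.I • emb A) g).le_opNorm (S.symm g)
    rw [opExt_add_emb_apply hA, ← hS, S.apply_symm_apply, S.symm.norm_map,
      inner_self_eq_norm_sq_to_K] at h
    have hg' : 0 < ‖g‖ := norm_pos_iff.mpr hg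
    refine le_of_mul_le_mul_right ?_ hg'
    simpa [sq] using h

theorem opExt_add_emb_surjective (hA : IsSelfAdjoint A) :
    Function.Surjective (opExt A + Complex.I • emb A) := by
  intro h
  set S := shiftEquiv hA norm_neg_I.1 norm_neg_I.2 with hS
  -- Riesz representation needs a linear functional, hence the conjugation of h.
  set l : H →L[ℂ] ℂ :=
    (starL ℂ : ℂ ≃L⋆[ℂ] ℂ).toContinuousLinearMap.comp
      (h.comp S.symm.toContinuousLinearEquiv.toContinuousLinearMap) with hl
  refine ⟨(InnerProductSpace.toDual ℂ H).symm l, ?_⟩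
  ext f
  rw [opExt_add_emb_apply hA, ← inner_conj_symm, InnerProductSpace.toDual_symm_apply]
  change conj (conj (h (S.symm (S f)))) = h f
  rw [S.symm_apply_apply, Complex.conj_conj]

/-- The operator `𝐀 + i` is a unitary operator from `H` to `H₋`. -/
def opExtEquiv (hA : IsSelfAdjoint A) : H ≃ₗᵢ[ℂ] HMinus A :=
  LinearIsometryEquiv.ofSurjective
    ⟨(opExt A + Complex.I • emb A).toLinearMap, norm_opExt_add_emb hA⟩
    (opExt_add_emb_surjective hA)

theorem coe_opExtEquiv (hA : IsSelfAdjoint A) :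
    (opExtEquiv hA).toContinuousLinearEquiv.toContinuousLinearMap =
      opExt A + Complex.I • emb A := rfl

theorem isInvertible_opExt_add_emb (hA : IsSelfAdjoint A) :
    (opExt A + Complex.I • emb A).IsInvertible :=
  ⟨(opExtEquiv hA).toContinuousLinearEquiv, coe_opExtEquiv hA⟩

theorem inverse_opExt_add_emb (hA : IsSelfAdjoint A) :
    (opExt A + Complex.I • emb A).inverse =
      (opExtEquiv hA).symm.toContinuousLinearEquiv.toContinuousLinearMap := by
  rw [← coe_opExtEquiv hA, ContinuousLinearMap.inverse_equiv]
  rfl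

theorem isInvertible_id_add (hA : IsSelfAdjoint A) (hZ : ‖Z‖ < 1) :
    (ContinuousLinearMap.id ℂ H +
      (opExt A + Complex.I • emb A).inverse.comp Z).IsInvertible := by
  obtain ⟨U, hU⟩ := isUnit_one_add_of_norm_lt_one
    (B := (opExt A + Complex.I • emb A).inverse.comp Z) (by
      refine lt_of_le_of_lt
        (ContinuousLinearMap.opNorm_le_bound _ (norm_nonneg Z) fun x => ?_) hZ
      rw [inverse_opExt_add_emb hA]
      exact ((opExtEquiv hA).symm.norm_map (Z x)).trans_le (Z.le_opNorm x))
  exact ⟨ContinuousLinearEquiv.unitsEquiv ℂ H U, hU⟩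

/-- With E = 𝐀 + i, E(1 + E⁻¹Z)h = (𝐀 + Z)h + ih lies in H exactly when (𝐀 + Z)h does. As E is
injective and restricts to A + i, which maps dom A onto H, Ex ∈ H exactly for x ∈ dom A. -/
theorem mem_adjoint_domain_iff_mem_domain (hA : IsSelfAdjoint A) {h : H} :
    h ∈ (singularPert A Z).adjoint.domain ↔
      (ContinuousLinearMap.id ℂ H + (opExt A + Complex.I • emb A).inverse.comp Z) h ∈
        A.domain := by
  have hinv := isInvertible_opExt_add_emb hA
  set E := opExt A + Complex.I • emb A with hE
  have hEh (x : H) : E x = opExt A x + Complex.I • emb A x := rfl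
  have h1 : E ((ContinuousLinearMap.id ℂ H + E.inverse.comp Z) h) =
      (opExt A + Z) h + emb A (Complex.I • h) := by
    simp only [add_apply, ContinuousLinearMap.comp_apply,
      ContinuousLinearMap.id_apply, map_add, hinv.self_apply_inverse, hEh h, map_smul]
    abel
  have h2 (f : HPlus A) : E (incl A f) = emb A (shift A Complex.I f) := by
    rw [hEh, opExt_incl hA, shift_apply, map_add, map_smul]
  rw [mem_adjoint_domain_iff_exists hA]
  constructor
  · rintro ⟨w, hw⟩
    obtain ⟨f, hf⟩ := shift_surjective hA Complex.norm_I Complex.I_re (w + Complex.I • h)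
    have h3 : E (incl A f) = E ((ContinuousLinearMap.id ℂ H + E.inverse.comp Z) h) := by
      rw [h1, h2, hf, hw, map_add]
    rw [← hinv.injective h3]
    exact incl_mem A f
  · intro hm
    refine ⟨shift A Complex.I (toHPlus A ⟨_, hm⟩) - Complex.I • h, ?_⟩
    rw [map_sub, ← h2, incl_toHPlus, h1, add_sub_cancel_right]

theorem adjoint_domain_eq (hA : IsSelfAdjoint A) (hZ : ‖Z‖ < 1) :
    (singularPert A Z).adjoint.domain =
      A.domain.map (ContinuousLinearMap.id ℂ H +
        (opExt A + Complex.I • emb A).inverse.comp Z).inverse.toLinearMap := by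
  have hW := isInvertible_id_add hA hZ
  ext h
  rw [mem_adjoint_domain_iff_mem_domain hA, Submodule.mem_map]
  constructor
  · exact fun hm => ⟨_, hm, hW.inverse_apply_self h⟩
  · rintro ⟨x, hx, rfl⟩
    have := hW.self_apply_inverse x
    exact this.symm ▸ hx

end Perturbation

/-! ### The codimension of `dom T ∩ dom T*` -/

/-- A finite rank operator is split over every densely embedded space. -/
theorem exists_splitting_of_denseRange {V W : Type*} [NormedAddCommGroup V] [NormedSpace ℂ V]
    [NormedAddCommGroup W] [NormedSpace ℂ W] (j : V →L[ℂ] H) (hj : DenseRange j) (Z : H →L[ℂ] W)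
    (hfin : Module.rank ℂ (LinearMap.range Z.toLinearMap) < Cardinal.aleph0) :
    ∃ Q : H →L[ℂ] V, ∀ x, Z (j (Q x)) = Z x := by
  have : FiniteDimensional ℂ (LinearMap.range Z.toLinearMap) := Module.rank_lt_aleph0_iff.mp hfin
  set g : V →ₗ[ℂ] LinearMap.range Z.toLinearMap :=
    Z.toLinearMap.rangeRestrict ∘ₗ j.toLinearMap with hg
  have hcl : IsClosed ((LinearMap.range g : Submodule ℂ _) : Set (LinearMap.range Z.toLinearMap)) :=
    Submodule.closed_of_finiteDimensional _
  set Zr : H →L[ℂ] LinearMap.range Z.toLinearMap :=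
    Z.codRestrict (LinearMap.range Z.toLinearMap) fun x => ⟨x, rfl⟩ with hZr
  -- A finite-dimensional subspace is closed, so the image of the dense subspace already fills ran
  -- Z.
  have hall (x : H) : Zr x ∈ LinearMap.range g := by
    have hd : closure (Set.range j) ⊆ Zr ⁻¹' (LinearMap.range g : Submodule ℂ _) :=
      closure_minimal (by rintro _ ⟨v, rfl⟩; exact ⟨v, rfl⟩) (hcl.preimage Zr.continuous)
    exact hd (hj x)
  have hsurj : LinearMap.range g = ⊤ := by
    rw [eq_top_iff]
    rintro ⟨_, x, rfl⟩ -
    exact hall x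
  obtain ⟨s, hs⟩ := g.exists_rightInverse_of_surjective hsurj
  refine ⟨(LinearMap.toContinuousLinearMap s).comp Zr, fun x => ?_⟩
  exact congrArg Subtype.val (DFunLike.congr_fun hs (Zr x))

section Perturbation

variable {A : H →ₗ.[ℂ] H} {Z : H →L[ℂ] HMinus A}

/-- A bounded operator from `H` to `H₊` that splits `Z` when `Z` has finite rank. -/
theorem exists_splitting (hA : Dense (A.domain : Set H))
    (hfin : Module.rank ℂ (LinearMap.range Z.toLinearMap) < Cardinal.aleph0) :
    ∃ Q : H →L[ℂ] HPlus A, ∀ x, Z (incl A (Q x)) = Z x := by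
  refine exists_splitting_of_denseRange (incl A) (hA.mono fun u hu => ?_) Z hfin
  exact ⟨toHPlus A ⟨u, hu⟩, rfl⟩

/-- With ZQ = Z, the operator P = 1 - Q maps dom A into dom A ∩ ker Z. For x ∈ ker Z, Px is thus a
limit of such vectors and Qx is itself one. -/
theorem topologicalClosure_domain_inf_ker (hA : Dense (A.domain : Set H))
    (hfin : Module.rank ℂ (LinearMap.range Z.toLinearMap) < Cardinal.aleph0) :
    (A.domain ⊓ LinearMap.ker Z.toLinearMap).topologicalClosure =
      LinearMap.ker Z.toLinearMap := by
  obtain ⟨Q, hQ⟩ := exists_splitting hA hfin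
  refine le_antisymm (Submodule.topologicalClosure_minimal _ inf_le_right Z.isClosed_ker) ?_
  intro x hx
  have hQx : incl A (Q x) ∈ A.domain := incl_mem A _
  set P : H →L[ℂ] H := ContinuousLinearMap.id ℂ H - (incl A).comp Q with hP
  have hm : Set.MapsTo P A.domain
      (A.domain ⊓ LinearMap.ker Z.toLinearMap : Submodule ℂ H) := fun u hu =>
    ⟨A.domain.sub_mem (x := u) hu (incl_mem A (Q u)), by
      change Z (u - incl A (Q u)) = 0
      rw [map_sub, hQ, sub_self]⟩
  have h1 : P x ∈ (A.domain ⊓ LinearMap.ker Z.toLinearMap).topologicalClosure :=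
    map_mem_closure P.continuous (hA x) hm
  have h2 : incl A (Q x) ∈ (A.domain ⊓ LinearMap.ker Z.toLinearMap).topologicalClosure :=
    Submodule.le_topologicalClosure _ ⟨hQx, (hQ x).trans hx⟩
  have := add_mem h1 h2
  rwa [show P x + incl A (Q x) = x from sub_add_cancel x _] at this

theorem hilbertCodim_domain_inf_ker (hA : Dense (A.domain : Set H))
    (hfin : Module.rank ℂ (LinearMap.range Z.toLinearMap) < Cardinal.aleph0) :
    hilbertCodim (A.domain ⊓ LinearMap.ker Z.toLinearMap) =
      Module.rank ℂ (LinearMap.range Z.toLinearMap) := by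
  rw [hilbertCodim, topologicalClosure_domain_inf_ker hA hfin]
  exact Z.toLinearMap.quotKerEquivRange.rank_eq

theorem emb_injective (hA : Dense (A.domain : Set H)) {g : H} (h : emb A g = 0) : g = 0 := by
  refine hA.eq_zero_of_inner_right ℂ fun v hv => ?_
  exact DFunLike.congr_fun h (toHPlus A ⟨v, hv⟩)

variable [CompleteSpace H]

/-- On dom A the term 𝐀f already lies in H, so f ∈ dom T* forces Zf ∈ ran Z ∩ H = {0}. -/
theorem domain_inf_adjoint_domain (hA : IsSelfAdjoint A)
    (hran : LinearMap.range Z.toLinearMap ⊓ LinearMap.range (emb A).toLinearMap = ⊥) :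
    (singularPert A Z).domain ⊓ (singularPert A Z).adjoint.domain =
      A.domain ⊓ LinearMap.ker Z.toLinearMap := by
  have key (f : HPlus A) : incl A f ∈ (singularPert A Z).adjoint.domain ↔ Z (incl A f) = 0 := by
    rw [mem_adjoint_domain_iff_exists hA]
    constructor
    · rintro ⟨w, hw⟩
      rw [add_apply, opExt_incl hA] at hw
      have h : Z (incl A f) ∈
          LinearMap.range Z.toLinearMap ⊓ LinearMap.range (emb A).toLinearMap := by
        refine ⟨⟨_, rfl⟩, ⟨w - op A f, ?_⟩⟩
        change emb A (w - op A f) = _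
        rw [map_sub, ← hw, add_sub_cancel_left]
      rwa [hran] at h
    · intro h
      exact ⟨op A f, by rw [add_apply, opExt_incl hA, h, add_zero]⟩
  ext x
  simp only [Submodule.mem_inf]
  exact and_congr_right fun hx => key (toHPlus A ⟨x, hx⟩)

/-! ### The numerical range of the perturbed operator -/

theorem div_mem_numRange (f : HPlus A) (hf : incl A f ≠ 0) :
    ⟪incl A f, op A f + adjOfMinus Z f⟫_ℂ / ((‖incl A f‖ ^ 2 : ℝ) : ℂ) ∈
      numRange (singularPert A Z) := by
  have hn : ((‖incl A f‖ ^ 2 : ℝ) : ℂ) ≠ 0 := by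
    exact_mod_cast pow_ne_zero 2 (norm_ne_zero_iff.mpr hf)
  refine mem_numRange_of_shiftedForm (u := (f.toDomain : (singularPert A Z).domain))
    (fun h => hf (congrArg Subtype.val h)) ?_
  change ⟪incl A f, op A f + adjOfMinus Z f - (_ : ℂ) • incl A f⟫_ℂ = 0
  rw [inner_sub_right, inner_smul_right, inner_self_eq_norm_sq_to_K, sub_eq_zero]
  refine Eq.trans (div_mul_cancel₀ _ hn).symm (congrArg _ ?_)
  exact Complex.ofReal_pow _ _

/-- Up to an error that is bounded with respect to the norm of `H`, the form of `A` is determined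
by its values on `dom A ∩ ker Z`. -/
theorem exists_form_approx (hA : IsSelfAdjoint A)
    (hfin : Module.rank ℂ (LinearMap.range Z.toLinearMap) < Cardinal.aleph0) :
    ∃ C : ℝ, ∀ u : HPlus A, ∃ d : HPlus A, Z (incl A d) = 0 ∧
      ‖incl A d‖ ≤ C * ‖incl A u‖ ∧
      |(⟪incl A u, op A u⟫_ℂ).re - (⟪incl A d, op A d⟫_ℂ).re| ≤ C * ‖incl A u‖ ^ 2 := by
  obtain ⟨Q, hQ⟩ := exists_splitting (Z := Z) hA.dense_domain hfin
  set q := ‖Q‖ with hq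
  have hq0 : 0 ≤ q := norm_nonneg Q
  refine ⟨1 + q + (2 * (1 + q) * q + q * q), fun u => ?_⟩
  set x := incl A u with hx
  set f := Q x with hf
  have hfn : ‖f‖ ≤ q * ‖x‖ := Q.le_opNorm x
  have h0 := norm_sq_HPlus A f
  have hf1 : ‖incl A f‖ ≤ q * ‖x‖ := le_trans
    (abs_le_of_sq_le_sq' (by nlinarith [sq_nonneg ‖op A f‖]) (norm_nonneg _)).2 hfn
  have hf2 : ‖op A f‖ ≤ q * ‖x‖ := le_trans
    (abs_le_of_sq_le_sq' (by nlinarith [sq_nonneg ‖incl A f‖]) (norm_nonneg _)).2 hfn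
  -- The correction f = Qx is bounded in H₊ by the H-norm of x, so both f and Af are controlled by
  -- ‖x‖.
  obtain ⟨d, hd⟩ : ∃ d, u = d + f := ⟨u - f, (sub_add_cancel u f).symm⟩
  have hxd : x = incl A d + incl A f := by rw [hx, hd, map_add]
  have hd1 : ‖incl A d‖ ≤ (1 + q) * ‖x‖ := by
    rw [eq_sub_of_add_eq hxd.symm]
    linarith [norm_sub_le x (incl A f)]
  have hx0 := norm_nonneg x
  refine ⟨d, ?_, hd1.trans ?_, ?_⟩
  · have := hQ x
    rw [← hf, hxd, map_add, right_eq_add] at this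
    exact this
  · refine mul_le_mul_of_nonneg_right ?_ hx0
    exact le_add_of_nonneg_right (by positivity)
  -- ‖Ad‖ is not controlled by ‖x‖; symmetry moves A from d onto f.
  · have hsymm : (⟪incl A f, op A d⟫_ℂ).re = (⟪incl A d, op A f⟫_ℂ).re := by
      rw [← inner_op_incl hA f d, ← inner_conj_symm, Complex.conj_re]
    have e : (⟪x, op A u⟫_ℂ).re - (⟪incl A d, op A d⟫_ℂ).re =
        2 * (⟪incl A d, op A f⟫_ℂ).re + (⟪incl A f, op A f⟫_ℂ).re := by
      rw [hxd, hd, map_add, inner_add_left, inner_add_right, inner_add_right]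
      simp only [Complex.add_re, hsymm]
      ring
    have b1 : |(⟪incl A d, op A f⟫_ℂ).re| ≤ ((1 + q) * ‖x‖) * (q * ‖x‖) :=
      (Complex.abs_re_le_norm _).trans ((norm_inner_le_norm _ _).trans (by gcongr))
    have b2 : |(⟪incl A f, op A f⟫_ℂ).re| ≤ (q * ‖x‖) * (q * ‖x‖) :=
      (Complex.abs_re_le_norm _).trans ((norm_inner_le_norm _ _).trans (by gcongr))
    rw [e]
    calc _ ≤ 2 * |(⟪incl A d, op A f⟫_ℂ).re| + |(⟪incl A f, op A f⟫_ℂ).re| := by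
          refine (abs_add_le _ _).trans_eq ?_
          rw [abs_mul, abs_two]
      _ ≤ 2 * (((1 + q) * ‖x‖) * (q * ‖x‖)) + (q * ‖x‖) * (q * ‖x‖) := by gcongr
      _ = (2 * (1 + q) * q + q * q) * ‖x‖ ^ 2 := by ring
      _ ≤ _ := by
        refine mul_le_mul_of_nonneg_right ?_ (by positivity)
        exact le_add_of_nonneg_left (by positivity)

theorem inner_adjOfMinus_self {d : HPlus A} (hd : Z (incl A d) = 0) :
    ⟪incl A d, adjOfMinus Z d⟫_ℂ = 0 := by
  rw [← inner_conj_symm, inner_adjOfMinus, hd]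
  simp

theorem re_div_mem_numRange (hA : IsSelfAdjoint A) {d : HPlus A} (hd : Z (incl A d) = 0)
    (hd0 : incl A d ≠ 0) :
    (((⟪incl A d, op A d⟫_ℂ).re / ‖incl A d‖ ^ 2 : ℝ) : ℂ) ∈ numRange (singularPert A Z) := by
  have h := div_mem_numRange (Z := Z) d hd0
  rw [inner_add_right, inner_adjOfMinus_self hd, add_zero] at h
  rwa [Complex.ofReal_div, show (((⟪incl A d, op A d⟫_ℂ).re : ℝ) : ℂ) = ⟪incl A d, op A d⟫_ℂ from
    Complex.ext (by simp) (by simp [im_inner_op hA])]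

/-- If `A` is not semibounded, then the numerical range of `T` contains the real axis. -/
theorem ofReal_mem_numRange (hA : IsSelfAdjoint A)
    (hfin : Module.rank ℂ (LinearMap.range Z.toLinearMap) < Cardinal.aleph0) (hs : ¬ IsSemibounded A) (x : ℝ) :
    (x : ℂ) ∈ numRange (singularPert A Z) := by
  obtain ⟨C, hC⟩ := exists_form_approx hA hfin
  simp only [IsSemibounded, not_or, not_exists, not_forall, not_le] at hs
  have bound (d u : HPlus A) (h : ‖incl A d‖ ≤ C * ‖incl A u‖) :
      |x| * ‖incl A d‖ ^ 2 ≤ |x| * C ^ 2 * ‖incl A u‖ ^ 2 := by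
    rw [mul_assoc, ← mul_pow]
    gcongr
  obtain ⟨p, hp, hpx⟩ : ∃ p : ℝ, (p : ℂ) ∈ numRange (singularPert A Z) ∧ p ≤ x := by
    -- Of this threshold, C absorbs the error in the form and |x|C² accounts for ‖d‖ ≤ C‖u‖;
    -- strictness yields d ≠ 0.
    obtain ⟨u, hu⟩ := hs.1 (-(|x| * C ^ 2) - C)
    obtain ⟨d, hd, hdn, hdu⟩ := hC (toHPlus A u)
    have h1 := bound d _ hdn
    rw [abs_le] at hdu
    rw [incl_toHPlus, op_toHPlus] at *
    have h2 : (⟪incl A d, op A d⟫_ℂ).re < -(|x| * ‖incl A d‖ ^ 2) := by nlinarith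
    have hd0 : incl A d ≠ 0 := fun h => by simp [h] at h2
    refine ⟨_, re_div_mem_numRange hA hd hd0, ?_⟩
    rw [div_le_iff₀ (by positivity)]
    nlinarith [neg_abs_le x, sq_nonneg ‖incl A d‖]
  obtain ⟨q, hq, hqx⟩ : ∃ q : ℝ, (q : ℂ) ∈ numRange (singularPert A Z) ∧ x ≤ q := by
    obtain ⟨u, hu⟩ := hs.2 (|x| * C ^ 2 + C)
    obtain ⟨d, hd, hdn, hdu⟩ := hC (toHPlus A u)
    have h1 := bound d _ hdn
    rw [abs_le] at hdu
    rw [incl_toHPlus, op_toHPlus] at *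
    have h2 : |x| * ‖incl A d‖ ^ 2 < (⟪incl A d, op A d⟫_ℂ).re := by nlinarith
    have hd0 : incl A d ≠ 0 := fun h => by simp [h] at h2
    refine ⟨_, re_div_mem_numRange hA hd hd0, ?_⟩
    rw [le_div_iff₀ (by positivity)]
    nlinarith [le_abs_self x, sq_nonneg ‖incl A d‖]
  have hconv : Convex ℝ {t : ℝ | (t : ℂ) ∈ numRange (singularPert A Z)} :=
    (convex_numRange (singularPert A Z)).linear_preimage Complex.ofRealCLM.toLinearMap
  exact hconv.ordConnected.out hp hq ⟨hpx, hqx⟩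

/-- If `ran Z ∩ H = {0}`, then the graph of `Z^×` in `H × H` is dense in `H × ran Z^×`. -/
theorem mem_closure_graph (hA : Dense (A.domain : Set H))
    (hran : LinearMap.range Z.toLinearMap ⊓ LinearMap.range (emb A).toLinearMap = ⊥)
    (x : H) (f : HPlus A) :
    (x, adjOfMinus Z f) ∈ closure (Set.range fun u : HPlus A => (incl A u, adjOfMinus Z u)) := by
  -- The L² product makes H × H a Hilbert space, so the closure is a double orthogonal complement.
  set G : HPlus A →ₗ[ℂ] WithLp 2 (H × H) :=
    (WithLp.linearEquiv 2 ℂ (H × H)).symm.toLinearMap ∘ₗ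
      ((incl A).toLinearMap.prod (adjOfMinus Z).toLinearMap) with hG
  have hmem : WithLp.toLp 2 (x, adjOfMinus Z f) ∈ (LinearMap.range G)ᗮᗮ := by
    rw [Submodule.mem_orthogonal]
    intro v hv
    have hv' (u : HPlus A) : ⟪incl A u, v.fst⟫_ℂ + ⟪adjOfMinus Z u, v.snd⟫_ℂ = 0 := by
      have := (Submodule.mem_orthogonal _ _).mp hv (G u) ⟨u, rfl⟩
      rwa [WithLp.prod_inner_apply] at this
    -- Orthogonality to the graph places Z v₂ in H, so Z v₂ = 0 and v₁ = 0. Then v₂ ∈ ker Z is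
    -- orthogonal to ran Z^×.
    have h1 : emb A v.fst + Z v.snd = 0 := by
      ext u
      rw [add_apply, ← inner_adjOfMinus Z]
      exact hv' u
    have h2 : Z v.snd ∈ LinearMap.range Z.toLinearMap ⊓ LinearMap.range (emb A).toLinearMap := by
      refine ⟨⟨_, rfl⟩, ⟨-v.fst, ?_⟩⟩
      change emb A (-v.fst) = _
      rw [map_neg]
      exact (eq_neg_of_add_eq_zero_right h1).symm
    rw [hran] at h2
    have h3 : Z v.snd = 0 := h2
    rw [h3, add_zero] at h1
    rw [WithLp.prod_inner_apply]
    change ⟪v.fst, x⟫_ℂ + ⟪v.snd, adjOfMinus Z f⟫_ℂ = 0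
    rw [emb_injective hA h1, inner_zero_left, zero_add, ← inner_conj_symm, inner_adjOfMinus, h3]
    simp
  rw [Submodule.orthogonal_orthogonal_eq_closure] at hmem
  refine map_mem_closure (f := WithLp.ofLp) (WithLp.prod_continuous_ofLp 2 H H) hmem ?_
  rintro _ ⟨u, rfl⟩
  exact ⟨u, rfl⟩

/-- The symmetric part A contributes nothing to Im (Tu, u). The pair (w, iε(c + 1)w) with w ∈ ran
Z^× is a limit of pairs (u, Z^×u), and the strict bound, being open, holds for a nearby u. The sign
ε covers both directions. -/
theorem exists_numRange_im (hA : IsSelfAdjoint A)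
    (hran : LinearMap.range Z.toLinearMap ⊓ LinearMap.range (emb A).toLinearMap = ⊥)
    (hZ0 : Z ≠ 0) {ε : ℝ} (hε : ε ^ 2 = 1) (c : ℝ) :
    ∃ p ∈ numRange (singularPert A Z), c < ε * p.im := by
  obtain ⟨f, hf⟩ : ∃ f, adjOfMinus Z f ≠ 0 := by
    by_contra! h
    refine hZ0 (ContinuousLinearMap.ext fun g => ContinuousLinearMap.ext fun f => ?_)
    rw [← inner_adjOfMinus, h]
    simp
  set w := adjOfMinus Z f with hw
  have hwn : 0 < ‖w‖ ^ 2 := by positivity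
  have hcl := mem_closure_graph hA.dense_domain hran w ((Complex.I * (ε * (c + 1) : ℝ)) • f)
  rw [map_smul, ← hw] at hcl
  have hopen : IsOpen {p : H × H | c * ‖p.1‖ ^ 2 < ε * (⟪p.1, p.2⟫_ℂ).im} :=
    isOpen_lt (by fun_prop) (continuous_const.mul
      (Complex.continuous_im.comp (continuous_fst.inner continuous_snd)))
  obtain ⟨_, hp, u, rfl⟩ := mem_closure_iff.mp hcl _ hopen (by
    change c * ‖w‖ ^ 2 < ε * (⟪w, (Complex.I * (ε * (c + 1) : ℝ)) • w⟫_ℂ).im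
    rw [inner_smul_right, inner_self_eq_norm_sq_to_K]
    change c * ‖w‖ ^ 2 < ε * (Complex.I * (ε * (c + 1) : ℝ) * (‖w‖ : ℂ) ^ 2).im
    rw [← Complex.ofReal_pow, mul_assoc, ← Complex.ofReal_mul, Complex.I_mul_im, Complex.ofReal_re]
    have : ε * (ε * (c + 1) * ‖w‖ ^ 2) = (c + 1) * ‖w‖ ^ 2 := by
      linear_combination (c + 1) * ‖w‖ ^ 2 * hε
    rw [this]
    linarith)
  have hp' : c * ‖incl A u‖ ^ 2 < ε * (⟪incl A u, adjOfMinus Z u⟫_ℂ).im := hp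
  have hu : incl A u ≠ 0 := fun h => by simp [h] at hp'
  refine ⟨_, div_mem_numRange u hu, ?_⟩
  rw [Complex.div_ofReal_im, inner_add_right, Complex.add_im, im_inner_op hA, zero_add,
    mul_div_assoc', lt_div_iff₀ (by positivity)]
  exact hp'

theorem numRange_eq_univ (hA : IsSelfAdjoint A)
    (hfin : Module.rank ℂ (LinearMap.range Z.toLinearMap) < Cardinal.aleph0)
    (hran : LinearMap.range Z.toLinearMap ⊓ LinearMap.range (emb A).toLinearMap = ⊥)
    (hZ0 : Z ≠ 0) (hs : ¬ IsSemibounded A) : numRange (singularPert A Z) = Set.univ := by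
  refine eq_univ_of_convex (convex_numRange _) (ofReal_mem_numRange hA hfin hs) (fun c => ?_) fun c => ?_
  · simpa using exists_numRange_im hA hran hZ0 (one_pow 2) c
  · obtain ⟨p, hp, h⟩ := exists_numRange_im hA hran hZ0 (ε := -1) (by norm_num) (-c)
    exact ⟨p, hp, by linarith⟩

end Perturbation

end SingularPerturbation

end

open SingularPerturbation LinearPMap in
theorem mainTheorem5 {H : Type*} [NormedAddCommGroup H] [InnerProductSpace ℂ H] [CompleteSpace H]
    [TopologicalSpace.SeparableSpace H]
    (A : H →ₗ.[ℂ] H) (hA : IsSelfAdjoint A) (hunb : IsUnbounded A)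
    (Z : H →L[ℂ] HMinus A) (hZ : ‖Z‖ < 1)
    (n : ℕ) (hn : 1 ≤ n) (hrank : Module.rank ℂ (LinearMap.range Z.toLinearMap) = n)
    (hran : LinearMap.range Z.toLinearMap ⊓ LinearMap.range (emb A).toLinearMap = ⊥) :
    -- `T` is closed
    (singularPert A Z).IsClosed ∧
    -- `ρ(T)` meets the open upper, lower, right and left half-planes
    (∃ z ∈ resolventSet (singularPert A Z), 0 < z.im) ∧
    (∃ z ∈ resolventSet (singularPert A Z), z.im < 0) ∧
    (∃ z ∈ resolventSet (singularPert A Z), 0 < z.re) ∧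
    (∃ z ∈ resolventSet (singularPert A Z), z.re < 0) ∧
    -- the inverses in the formula for the adjoint exist as bounded operators
    (opExt A + Complex.I • emb A).IsInvertible ∧
    (ContinuousLinearMap.id ℂ H + (opExt A + Complex.I • emb A).inverse.comp Z).IsInvertible ∧
    -- the domain of the adjoint of `T`, and its action
    (singularPert A Z).adjoint.domain =
      A.domain.map (ContinuousLinearMap.id ℂ H +
        (opExt A + Complex.I • emb A).inverse.comp Z).inverse.toLinearMap ∧
    (∀ u : (singularPert A Z).adjoint.domain,
      emb A ((singularPert A Z).adjoint u) = (opExt A + Z) (u : H)) ∧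
    -- the codimension of `dom T ∩ dom T*`
    hilbertCodim ((singularPert A Z).domain ⊓ (singularPert A Z).adjoint.domain) = n ∧
    -- the additional claims
    (¬ IsSemibounded A → numRange (singularPert A Z) = Set.univ) ∧
    (HasCompactResolvent A → HasCompactResolvent (singularPert A Z)) := by
  have hres := mem_resolventSet_singularPert hA hZ norm_neg_I.1 norm_neg_I.2
  have hres' := mem_resolventSet_singularPert hA hZ Complex.norm_I Complex.I_re
  rw [neg_neg] at hres
  have hfin : Module.rank ℂ (LinearMap.range Z.toLinearMap) < Cardinal.aleph0 :=
    hrank ▸ Cardinal.natCast_lt_aleph0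
  have hZ0 : Z ≠ 0 := by
    rintro rfl
    rw [ContinuousLinearMap.toLinearMap_zero, LinearMap.range_zero, rank_bot] at hrank
    exact absurd (Nat.cast_eq_zero.mp hrank.symm) (by omega)
  obtain ⟨R, hR⟩ := hres
  refine ⟨isClosed_of_isResolventAt hR, ⟨_, ⟨R, hR⟩, by simp⟩, ⟨_, hres', by simp⟩,
    (exists_re_of_mem_resolventSet ⟨R, hR⟩).1, (exists_re_of_mem_resolventSet ⟨R, hR⟩).2,
    isInvertible_opExt_add_emb hA, isInvertible_id_add hA hZ, adjoint_domain_eq hA hZ,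
    emb_adjoint_apply hA, ?_, numRange_eq_univ hA hfin hran hZ0, hasCompactResolvent_singularPert hA hZ⟩
  rw [domain_inf_adjoint_domain hA hran, hilbertCodim_domain_inf_ker hA.dense_domain hfin, hrank]
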